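/- Let $\mathbb K$ be a field with more than $2$ elements, and let $U$ and $V$ be finite-dimensional vector spaces over $\mathbb K$. Denote by $\mathcal L(U,V)$ the space of all linear maps from $U$ to $V$. For a subset $\mathcal S\subseteq\mathcal L(U,V)$, a map $F:\mathcal S\to V$ is called range-compatible if $F(s)\in\operatorname{im} s$ for all $s\in\mathcal S$, and local if there is a vector $x\in U$ such that $F(s)=s(x)$ for all $s\in\mathcal S$. The codimension of a (nonempty) affine subspace of $\mathcal L(U,V)$ is the codimension of its translation vector space in $\mathcal L(U,V)$. (a) Let $\mathcal S$ be an affine subspace of $\mathcal L(U,V)$ with $\operatorname{codim}\mathcal S\le\dim V-1$. Then every range-compatible affine map $F:\mathcal S\to V$ is local. (b) The bound in (a) is optimal: if $\dim U\ge 2$ and $\dim V\ge 2$, then there exist an affine subspace $\mathcal S$ of $\mathcal L(U,V)$ with $\operatorname{codim}\mathcal S=\dim V$ and a range-compatible affine map $F:\mathcal S\to V$ that is not local. -/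

import Mathlib

section RangeCompatible

variable {K U V : Type*} [Field K] [AddCommGroup U] [Module K U] [AddCommGroup V] [Module K V]

/-- A map `F : 𝒮 → V` on a set `𝒮` of linear maps from `U` to `V` is range-compatible when
`F s` lies in the range of `s` for every `s ∈ 𝒮`. -/
def IsRangeCompatible {S : Set (U →ₗ[K] V)} (F : S → V) : Prop :=
  ∀ s : S, F s ∈ LinearMap.range (s : U →ₗ[K] V)

/-- A map `F : 𝒮 → V` on a set `𝒮` of linear maps from `U` to `V` is local when it is the
evaluation at some fixed vector `x ∈ U`. -/
def IsLocalMap {S : Set (U →ₗ[K] V)} (F : S → V) : Prop :=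
  ∃ x : U, ∀ s : S, F s = (s : U →ₗ[K] V) x

end RangeCompatible

/-- The codimension of a (nonempty) affine subspace of a vector space `E`: the dimension of the
quotient of `E` by the translation vector space. -/
noncomputable def affineCodim {K E : Type*} [Field K] [AddCommGroup E] [Module K E]
    (S : AffineSubspace K E) : ℕ :=
  Module.finrank K (E ⧸ S.direction)

/-!
Write `F` row by row: for a linear form `z` on `V`, range-compatibility makes `z (F s)` vanish
whenever `z ∘ s = 0`. If the forms `z ∘ d`, with `d` in the direction of `𝒮`, fill the dual of `U`,
then `z ∘ s = 0` does occur on `𝒮`, so `z (F s)` is a linear function of `z ∘ s`, that is,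
`z (F s) = z (s x)` for some `x`. The other, degenerate, forms `z` come from rank-one elements
`s ↦ z (s u)` of the annihilator of the direction; as this annihilator has dimension less than
`dim V`, they all vanish at a common `v ≠ 0`.

Subtracting an evaluation, we may assume that `z ∘ F = 0` for some `z` with `z v ≠ 0`. For `h` with
`h v = 0` and `h ∘ F ≠ 0`, the rows of `F` at `z + h` and `z + a h`, `a ∉ {0, 1}`, are evaluations,
and eliminating `h ∘ F` leaves a nonzero element of the annihilator which vanishes on `𝒮`. If
`F ≠ 0`, such `h` span the hyperplane `h v = 0`, and the relations coming from `dim V - 1`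
independent ones exhaust the annihilator. So the annihilator vanishes on `𝒮`, whence `0 ∈ 𝒮` and
each row `h ∘ F` is itself an evaluation; comparing it with the row at `z + h` gives an element of
the annihilator that is not a combination of those relations.
-/

open Module

section LinearAlgebra

variable {K E : Type*} [Field K] [AddCommGroup E] [Module K E]

theorem exists_linearIndependent_mem_of_span_eq [FiniteDimensional K E] {s : Set E}
    {H : Submodule K E} (hs : Submodule.span K s = H) :
    ∃ h : Fin (finrank K H) → E, LinearIndependent K h ∧ ∀ i, h i ∈ s := by
  subst hs
  obtain ⟨h, hmem, -, hh⟩ := Submodule.exists_fun_fin_finrank_span_eq K s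
  exact ⟨h, hh, hmem⟩

theorem span_setOf_mem_and_notMem {H B : Submodule K E} (hHB : ¬H ≤ B) :
    Submodule.span K {h | h ∈ H ∧ h ∉ B} = H := by
  obtain ⟨h₀, h₀H, h₀B⟩ := Set.not_subset.1 hHB
  have h₀_mem : h₀ ∈ Submodule.span K {h | h ∈ H ∧ h ∉ B} := Submodule.subset_span ⟨h₀H, h₀B⟩
  refine le_antisymm (Submodule.span_le.2 fun h hh => hh.1) fun h hH => ?_
  by_cases hB : h ∈ B
  · have hadd : h + h₀ ∈ Submodule.span K {h | h ∈ H ∧ h ∉ B} :=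
      Submodule.subset_span ⟨H.add_mem hH h₀H, fun hmem => h₀B ((B.add_mem_iff_right hB).1 hmem)⟩
    exact (Submodule.add_mem_iff_left _ h₀_mem).1 hadd
  · exact Submodule.subset_span ⟨hH, hB⟩

theorem notMem_span_singleton_of_dual_apply_eq_zero {z : Dual K E} {v w : E} (hzv : z v ≠ 0)
    (hzw : z w = 0) (hw : w ≠ 0) : w ∉ Submodule.span K {v} := by
  intro hmem
  obtain ⟨c, rfl⟩ := Submodule.mem_span_singleton.1 hmem
  rw [map_smul, smul_eq_zero] at hzw
  exact hw (by rw [hzw.resolve_right hzv, zero_smul])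

theorem exists_linearIndependent_dual_apply_eq_zero_and_ne_zero [FiniteDimensional K E] {v w : E}
    (hv : v ≠ 0) (hw : w ∉ Submodule.span K {v}) :
    ∃ h : Fin (finrank K E - 1) → Dual K E,
      LinearIndependent K h ∧ ∀ i, h i v = 0 ∧ h i w ≠ 0 := by
  have hvw : ¬LinearMap.ker (Dual.eval K E v) ≤ LinearMap.ker (Dual.eval K E w) := by
    obtain ⟨f, hfw, hfv⟩ := Submodule.exists_le_ker_of_notMem hw
    exact fun hle => hfw (hle (hfv (Submodule.mem_span_singleton_self v)))
  obtain ⟨h, hh, hmem⟩ := exists_linearIndependent_mem_of_span_eq (span_setOf_mem_and_notMem hvw)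
  have heval : Dual.eval K E v ≠ 0 := (eval_apply_eq_zero_iff K v).not.2 hv
  have hfinrank : finrank K (LinearMap.ker (Dual.eval K E v)) = finrank K E - 1 := by
    rw [← Subspace.dual_finrank_eq, ← Dual.finrank_ker_add_one_of_ne_zero heval,
      Nat.add_sub_cancel]
  rw [← hfinrank]
  exact ⟨h, hh, hmem⟩

theorem finrank_dualAnnihilator_eq_finrank_quotient (M : Submodule K E) :
    finrank K M.dualAnnihilator = finrank K (E ⧸ M) := by
  rw [← M.dualQuotEquivDualAnnihilator.finrank_eq, Subspace.dual_finrank_eq]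

theorem span_range_eq_dualAnnihilator [FiniteDimensional K E] {ι : Type*} [Fintype ι]
    {M : Submodule K E} {ε : ι → Dual K E} (hε : LinearIndependent K ε)
    (hM : ∀ i, ε i ∈ M.dualAnnihilator) (hcard : finrank K (E ⧸ M) ≤ Fintype.card ι) :
    Submodule.span K (Set.range ε) = M.dualAnnihilator :=
  Submodule.eq_of_le_of_finrank_le (Submodule.span_le.2 (Set.range_subset_iff.2 hM)) (by
    rwa [finrank_span_eq_card hε, finrank_dualAnnihilator_eq_finrank_quotient])

theorem exists_forall_eq_apply_of_ker_le_ker {U : Type*} [AddCommGroup U] [Module K U]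
    [FiniteDimensional K U] {Φ : E →ₗ[K] Dual K U} {g : Dual K E}
    (hg : LinearMap.ker Φ ≤ LinearMap.ker g) : ∃ x : U, ∀ e, g e = Φ e x := by
  have hmem : g ∈ (LinearMap.ker Φ).dualAnnihilator :=
    (Submodule.mem_dualAnnihilator g).2 fun e he => hg he
  rw [← LinearMap.range_dualMap_eq_dualAnnihilator_ker] at hmem
  obtain ⟨L, rfl⟩ := hmem
  obtain ⟨x, rfl⟩ := (evalEquiv K U).surjective L
  exact ⟨x, fun e => rfl⟩

theorem mem_dualAnnihilator_direction {S : AffineSubspace K E} [Nonempty S] {g : Dual K E}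
    (hg : ∀ s ∈ S, g s = 0) : g ∈ S.direction.dualAnnihilator := by
  obtain ⟨s₀⟩ := ‹Nonempty S›
  refine (Submodule.mem_dualAnnihilator g).2 fun d hd => ?_
  have hadd := hg _ (AffineSubspace.vadd_mem_of_mem_direction hd s₀.2)
  rwa [vadd_eq_add, map_add, hg _ s₀.2, add_zero] at hadd

theorem zero_mem_of_dualAnnihilator_direction_le_span {S : AffineSubspace K E} [Nonempty S]
    {Γ : Set (Dual K E)} (hΓ : ∀ g ∈ Γ, ∀ s ∈ S, g s = 0)
    (hspan : S.direction.dualAnnihilator ≤ Submodule.span K Γ) : (0 : E) ∈ S := by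
  obtain ⟨s₀, hs₀⟩ := ‹Nonempty S›
  have hker : Submodule.span K Γ ≤ LinearMap.ker (Dual.eval K E s₀) :=
    Submodule.span_le.2 fun g hg => hΓ g hg s₀ hs₀
  have hdir : s₀ ∈ S.direction :=
    (Subspace.forall_mem_dualAnnihilator_apply_eq_zero_iff _ _).1 fun g hg => hker (hspan hg)
  simpa using AffineSubspace.vadd_mem_of_mem_direction (neg_mem hdir) hs₀

end LinearAlgebra

section MatrixCoeff

variable {K U V ι : Type*} [Field K] [AddCommGroup U] [Module K U] [AddCommGroup V] [Module K V]

/-- The linear form `s ↦ z (s u)` on `U →ₗ[K] V`, as a bilinear function of `z` and `u`. Under the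
trace pairing it corresponds to the operator `v ↦ z v • u` of rank at most one. -/
def matrixCoeff : Dual K V →ₗ[K] U →ₗ[K] Dual K (U →ₗ[K] V) :=
  LinearMap.mk₂ K (fun z u => z ∘ₗ LinearMap.applyₗ u)
    (fun _ _ _ => by ext; simp) (fun _ _ _ => by ext; simp)
    (fun _ _ _ => by ext; simp) (fun _ _ _ => by ext; simp)

@[simp]
theorem matrixCoeff_apply (z : Dual K V) (u : U) (s : U →ₗ[K] V) :
    matrixCoeff z u s = z (s u) := rfl

theorem eq_zero_of_sum_matrixCoeff_eq_zero [Fintype ι] {h : ι → Dual K V}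
    (hh : LinearIndependent K h) {q : ι → U} (hsum : ∑ i, matrixCoeff (h i) (q i) = 0) :
    q = 0 := by
  ext i
  refine (forall_dual_apply_eq_zero_iff K _).1 fun φ => ?_
  refine Fintype.linearIndependent_iff.1 hh (fun j => φ (q j)) (LinearMap.ext fun v => ?_) i
  simpa [LinearMap.sum_apply] using LinearMap.congr_fun hsum (φ.smulRight v)

theorem linearIndependent_matrixCoeff [Finite ι] {h : ι → Dual K V} (hh : LinearIndependent K h)
    {q : ι → U} (hq : ∀ i, q i ≠ 0) :
    LinearIndependent K (fun i => matrixCoeff (h i) (q i)) := by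
  have := Fintype.ofFinite ι
  refine Fintype.linearIndependent_iff.2 fun c hc i => ?_
  have hcq : (fun i => c i • q i) = 0 :=
    eq_zero_of_sum_matrixCoeff_eq_zero hh (by simpa only [map_smul] using hc)
  exact (smul_eq_zero.1 (congrFun hcq i)).resolve_right (hq i)

theorem eq_zero_of_sum_matrixCoeff_add_eq_zero [Fintype ι] {h : ι → Dual K V}
    (hh : LinearIndependent K h) {z : Dual K V} (hz : z ∉ Submodule.span K (Set.range h))
    {q : ι → U} {p : U} (hsum : ∑ i, matrixCoeff (h i) (q i) + matrixCoeff z p = 0) :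
    q = 0 ∧ p = 0 := by
  have hqp : (fun o => Option.casesOn' o p q) = 0 :=
    eq_zero_of_sum_matrixCoeff_eq_zero (hh.option hz) (by
      rw [Fintype.sum_option, add_comm]
      exact hsum)
  exact ⟨funext fun i => congrFun hqp (some i), congrFun hqp none⟩

theorem sum_smul_matrixCoeff_add [Fintype ι] (c : ι → K) (h : ι → Dual K V) (z : Dual K V)
    (q p : ι → U) :
    ∑ i, c i • (matrixCoeff (h i) (q i) + matrixCoeff z (p i)) =
      ∑ i, matrixCoeff (h i) (c i • q i) + matrixCoeff z (∑ i, c i • p i) := by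
  simp only [smul_add, Finset.sum_add_distrib, map_smul, map_sum]

theorem linearIndependent_matrixCoeff_add [Finite ι] {h : ι → Dual K V}
    (hh : LinearIndependent K h) {z : Dual K V} (hz : z ∉ Submodule.span K (Set.range h))
    {q : ι → U} (hq : ∀ i, q i ≠ 0) (p : ι → U) :
    LinearIndependent K (fun i => matrixCoeff (h i) (q i) + matrixCoeff z (p i)) := by
  have := Fintype.ofFinite ι
  refine Fintype.linearIndependent_iff.2 fun c hc i => ?_
  rw [sum_smul_matrixCoeff_add] at hc
  have hcq := (eq_zero_of_sum_matrixCoeff_add_eq_zero hh hz hc).1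
  exact (smul_eq_zero.1 (congrFun hcq i)).resolve_right (hq i)

theorem exists_smul_eq_of_matrixCoeff_add_mem_span [Finite ι] {h : ι → Dual K V}
    (hh : LinearIndependent K h) {z : Dual K V} (hz : z ∉ Submodule.span K (Set.range h))
    {q p : ι → U} (hq : ∀ i, q i ≠ 0) {k : ι} {r x : U}
    (hmem : matrixCoeff (h k) r + matrixCoeff z x ∈
      Submodule.span K (Set.range fun i => matrixCoeff (h i) (q i) + matrixCoeff z (p i))) :
    ∃ c : K, c • p k = x := by
  classical
  have := Fintype.ofFinite ι
  obtain ⟨c, hc⟩ := (Submodule.mem_span_range_iff_exists_fun K).1 hmem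
  have hr : matrixCoeff (h k) r = ∑ i, matrixCoeff (h i) ((Pi.single k r : ι → U) i) := by
    rw [Fintype.sum_eq_single k fun i hi => by simp [hi], Pi.single_eq_same]
  obtain ⟨hcq, hcp⟩ := eq_zero_of_sum_matrixCoeff_add_eq_zero hh hz
    (q := fun i => c i • q i - (Pi.single k r : ι → U) i) (p := ∑ i, c i • p i - x) (by
      simp only [map_sub, Finset.sum_sub_distrib]
      rw [sub_add_sub_comm, ← sum_smul_matrixCoeff_add, ← hr, hc, sub_self])
  have hc_ne (i : ι) (hi : i ≠ k) : c i = 0 := by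
    have hi0 := congrFun hcq i
    simp only [Pi.single_eq_of_ne hi, sub_zero, Pi.zero_apply] at hi0
    exact (smul_eq_zero.1 hi0).resolve_right (hq i)
  refine ⟨c k, ?_⟩
  rwa [Fintype.sum_eq_single k fun i hi => by simp [hc_ne i hi], sub_eq_zero] at hcp

end MatrixCoeff

section Nondegenerate

variable {K U V : Type*} [Field K] [AddCommGroup U] [Module K U] [AddCommGroup V] [Module K V]

/-- A linear form `z` on `V` is nondegenerate on a space `D` of operators when no nonzero vector
`u` is killed by all the rows `z ∘ d`, `d ∈ D`; for finite-dimensional `U` this says that these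
rows fill the dual of `U`. -/
def IsNondegenerateOn (z : Dual K V) (D : Submodule K (U →ₗ[K] V)) : Prop :=
  ∀ u : U, matrixCoeff z u ∈ D.dualAnnihilator → u = 0

variable {D : Submodule K (U →ₗ[K] V)}

theorem IsNondegenerateOn.exists_comp_eq [FiniteDimensional K U] {z : Dual K V}
    (hz : IsNondegenerateOn z D) (φ : Dual K U) : ∃ d ∈ D, z ∘ₗ d = φ := by
  have hspan : Submodule.span K (D.map (LinearMap.compRight K z) : Set (Dual K U)) = ⊤ := by
    refine Submodule.span_eq_top_of_ne_zero fun u hu => ?_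
    by_contra! hrow
    exact hu (hz u ((Submodule.mem_dualAnnihilator _).2 fun d hd =>
      hrow _ (Submodule.mem_map_of_mem hd)))
  rw [Submodule.span_eq] at hspan
  exact Submodule.mem_map.1 (hspan ▸ Submodule.mem_top : φ ∈ D.map (LinearMap.compRight K z))

theorem exists_ne_zero_forall_isNondegenerateOn [FiniteDimensional K U] [FiniteDimensional K V]
    (hD : finrank K ((U →ₗ[K] V) ⧸ D) < finrank K V) :
    ∃ v : V, v ≠ 0 ∧ ∀ z : Dual K V, z v ≠ 0 → IsNondegenerateOn z D := by
  by_contra! hdeg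
  have hspan : Submodule.span K {z : Dual K V | ¬IsNondegenerateOn z D} = ⊤ :=
    Submodule.span_eq_top_of_ne_zero fun v hv => (hdeg v hv).imp fun z hz => hz.symm
  obtain ⟨h, hh, hdeg_h⟩ := exists_linearIndependent_mem_of_span_eq hspan
  simp only [Set.mem_ofPred_eq, IsNondegenerateOn, not_forall, exists_prop] at hdeg_h
  choose u hu_mem hu_ne using hdeg_h
  have hind : LinearIndependent K fun i => (⟨_, hu_mem i⟩ : D.dualAnnihilator) :=
    LinearIndependent.of_comp D.dualAnnihilator.subtype (linearIndependent_matrixCoeff hh hu_ne)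
  have hcard := hind.fintype_card_le_finrank
  rw [Fintype.card_fin, finrank_top, Subspace.dual_finrank_eq,
    finrank_dualAnnihilator_eq_finrank_quotient] at hcard
  exact hcard.not_gt hD

theorem eq_zero_of_matrixCoeff_smul_add_mem {z h : Dual K V} {v : V} (hzv : z v ≠ 0)
    (hhv : h v = 0) (hv : ∀ y : Dual K V, y v ≠ 0 → IsNondegenerateOn y D) {x : U} (hx : x ≠ 0)
    {α β : K} (hmem : matrixCoeff h (α • x) + matrixCoeff z (β • x) ∈ D.dualAnnihilator) :
    β = 0 := by
  have heq : matrixCoeff h (α • x) + matrixCoeff z (β • x) = matrixCoeff (α • h + β • z) x := by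
    simp only [map_smul, map_add, LinearMap.add_apply, LinearMap.smul_apply]
  by_contra hβ
  have hne : (α • h + β • z) v ≠ 0 := by simp [hhv, hβ, hzv]
  exact hx (hv _ hne x (heq ▸ hmem))

end Nondegenerate

section RangeCompatibleAffine

variable {K U V : Type*} [Field K] [AddCommGroup U] [Module K U] [AddCommGroup V] [Module K V]
  [FiniteDimensional K U] {S : AffineSubspace K (U →ₗ[K] V)} [Nonempty S] {F : S →ᵃ[K] V}

theorem IsRangeCompatible.exists_row_eq_of_comp_eq_zero
    (hF : IsRangeCompatible (S := (S : Set (U →ₗ[K] V))) F) {z : Dual K V} {s₀ : S}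
    (hs₀ : z ∘ₗ (s₀ : U →ₗ[K] V) = 0) :
    ∃ x : U, ∀ s : S, z (F s) = z ((s : U →ₗ[K] V) x) := by
  have hrow (s : S) (hs : z ∘ₗ (s : U →ₗ[K] V) = 0) : z (F s) = 0 := by
    obtain ⟨u, hu⟩ := hF s
    rw [← hu]
    exact LinearMap.congr_fun hs u
  obtain ⟨x, hx⟩ := exists_forall_eq_apply_of_ker_le_ker
    (Φ := (LinearMap.compRight K z).domRestrict S.direction) (g := z ∘ₗ F.linear)
    fun d (hd : z ∘ₗ (d : U →ₗ[K] V) = 0) => by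
      have hadd := hrow (d +ᵥ s₀) (by
        simpa [LinearMap.comp_add, hs₀] using hd)
      rwa [F.map_vadd, vadd_eq_add, map_add, hrow s₀ hs₀, add_zero] at hadd
  refine ⟨x, fun s => ?_⟩
  have hlin := hx (s -ᵥ s₀)
  have hs₀x : z ((s₀ : U →ₗ[K] V) x) = 0 := LinearMap.congr_fun hs₀ x
  simpa [hrow s₀ hs₀, hs₀x] using hlin

theorem IsRangeCompatible.exists_row_eq_of_isNondegenerateOn
    (hF : IsRangeCompatible (S := (S : Set (U →ₗ[K] V))) F) {z : Dual K V}
    (hz : IsNondegenerateOn z S.direction) :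
    ∃ x : U, ∀ s : S, z (F s) = z ((s : U →ₗ[K] V) x) := by
  obtain ⟨s₁⟩ := ‹Nonempty S›
  obtain ⟨d, hd, hzd⟩ := hz.exists_comp_eq (-(z ∘ₗ (s₁ : U →ₗ[K] V)))
  refine hF.exists_row_eq_of_comp_eq_zero (s₀ := (⟨d, hd⟩ : S.direction) +ᵥ s₁) ?_
  simp [LinearMap.comp_add, hzd]

/-- Comparing the rows `z`, `z + h` and `z + a • h` of `F`, three points of a line, gives a form
vanishing on `S`; this is where a scalar `a ∉ {0, 1}` is needed. -/
theorem IsRangeCompatible.exists_matrixCoeff_add_vanishing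
    (hF : IsRangeCompatible (S := (S : Set (U →ₗ[K] V))) F) {z h : Dual K V} {v : V}
    (hzv : z v ≠ 0) (hhv : h v = 0) (hv : ∀ y : Dual K V, y v ≠ 0 → IsNondegenerateOn y S.direction)
    (hzF : ∀ s, z (F s) = 0) (hhF : ∃ s, h (F s) ≠ 0) {a : K} (ha₀ : a ≠ 0) (ha₁ : a ≠ 1) :
    ∃ x q p : U, q ≠ 0 ∧ (∀ c : K, c • p ≠ x) ∧
      (∀ s : S, h (F s) = (z + h) ((s : U →ₗ[K] V) x)) ∧
      ∀ s ∈ S, (matrixCoeff h q + matrixCoeff z p) s = 0 := by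
  obtain ⟨x, hx⟩ := hF.exists_row_eq_of_isNondegenerateOn (hv (z + h) (by simpa [hhv] using hzv))
  obtain ⟨y, hy⟩ :=
    hF.exists_row_eq_of_isNondegenerateOn (hv (z + a • h) (by simpa [hhv] using hzv))
  simp only [LinearMap.add_apply, LinearMap.smul_apply, smul_eq_mul, hzF, zero_add] at hx hy
  have hvanish (s : U →ₗ[K] V) (hs : s ∈ S) :
      (matrixCoeff h (a • (y - x)) + matrixCoeff z (y - a • x)) s = 0 := by
    rw [LinearMap.add_apply, matrixCoeff_apply, matrixCoeff_apply]
    simp only [map_smul, map_sub, smul_eq_mul]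
    linear_combination a * hx ⟨s, hs⟩ - hy ⟨s, hs⟩
  have hmem := mem_dualAnnihilator_direction hvanish
  have hx_ne : x ≠ 0 := by
    rintro rfl
    obtain ⟨s, hs⟩ := hhF
    exact hs (by simpa using hx s)
  refine ⟨x, a • (y - x), y - a • x, ?_, ?_, hx, hvanish⟩
  · intro hq
    obtain rfl : y = x := sub_eq_zero.1 ((smul_eq_zero.1 hq).resolve_left ha₀)
    have hβ := eq_zero_of_matrixCoeff_smul_add_mem (α := 0) (β := 1 - a) hzv hhv hv hx_ne
      (by simpa [sub_smul] using hmem)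
    exact ha₁ (sub_eq_zero.1 hβ).symm
  · intro c hc
    have hc_ne : c ≠ 0 := by
      rintro rfl
      exact hx_ne (by simpa using hc.symm)
    have hp : y - a • x = c⁻¹ • x := (eq_inv_smul_iff₀ hc_ne).2 hc
    have hq : a • (y - x) = (a * (a + c⁻¹ - 1)) • x := by
      rw [sub_eq_iff_eq_add.1 hp]
      module
    rw [hp, hq] at hmem
    exact inv_ne_zero hc_ne (eq_zero_of_matrixCoeff_smul_add_mem hzv hhv hv hx_ne hmem)

variable [FiniteDimensional K V]

theorem IsRangeCompatible.eq_zero_of_row_eq_zero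
    (hF : IsRangeCompatible (S := (S : Set (U →ₗ[K] V))) F) (hS : affineCodim S < finrank K V)
    {v : V} (hv : ∀ y : Dual K V, y v ≠ 0 → IsNondegenerateOn y S.direction) {z : Dual K V}
    (hzv : z v ≠ 0) (hzF : ∀ s, z (F s) = 0) {a : K} (ha₀ : a ≠ 0) (ha₁ : a ≠ 1) (s : S) :
    F s = 0 := by
  by_contra hFs
  have hFv := notMem_span_singleton_of_dual_apply_eq_zero hzv (hzF s) hFs
  have hv_ne : v ≠ 0 := fun h => hzv (h ▸ map_zero z)
  have hV : 1 < finrank K V := by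
    rw [← finrank_span_singleton (K := K) hv_ne]
    exact Submodule.finrank_lt fun htop => hFv (htop ▸ Submodule.mem_top)
  obtain ⟨h, hh, hhvF⟩ := exists_linearIndependent_dual_apply_eq_zero_and_ne_zero hv_ne hFv
  have hz_span : z ∉ Submodule.span K (Set.range h) := fun hmem =>
    hzv (Submodule.span_le (p := LinearMap.ker (Dual.eval K V v)).2
      (Set.range_subset_iff.2 fun i => (hhvF i).1) hmem)
  choose x q p hq hxp hrow hvanish using fun i => hF.exists_matrixCoeff_add_vanishing hzv
    (hhvF i).1 hv hzF ⟨s, (hhvF i).2⟩ ha₀ ha₁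
  have hspan := span_range_eq_dualAnnihilator
    (linearIndependent_matrixCoeff_add hh hz_span hq p)
    (fun i => mem_dualAnnihilator_direction (hvanish i))
    (by rw [Fintype.card_fin]; exact Nat.le_sub_one_of_lt hS)
  have hzero : (0 : U →ₗ[K] V) ∈ S :=
    zero_mem_of_dualAnnihilator_direction_le_span (Set.forall_mem_range.2 hvanish) hspan.ge
  let k : Fin (finrank K V - 1) := ⟨0, Nat.sub_pos_of_lt hV⟩
  obtain ⟨x', hx'⟩ :=
    hF.exists_row_eq_of_comp_eq_zero (s₀ := ⟨0, hzero⟩) (LinearMap.comp_zero (h k))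
  have hextra : matrixCoeff (h k) (x k - x') + matrixCoeff z (x k) ∈
      S.direction.dualAnnihilator := mem_dualAnnihilator_direction fun t ht => by
    have hxk := hrow k ⟨t, ht⟩
    rw [hx', LinearMap.add_apply] at hxk
    rw [LinearMap.add_apply, matrixCoeff_apply, matrixCoeff_apply, map_sub, map_sub]
    linear_combination -hxk
  obtain ⟨c, hc⟩ := exists_smul_eq_of_matrixCoeff_add_mem_span hh hz_span hq (hspan ▸ hextra)
  exact hxp k c hc

theorem IsRangeCompatible.isLocalMap_of_affineCodim_lt_finrank (hK : 2 < ENat.card K)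
    (hF : IsRangeCompatible (S := (S : Set (U →ₗ[K] V))) F) (hS : affineCodim S < finrank K V) :
    IsLocalMap (S := (S : Set (U →ₗ[K] V))) F := by
  obtain ⟨a, ha₀, ha₁⟩ := ENat.exists_ne_ne_of_three_le (Order.add_one_le_of_lt hK) (0 : K) 1
  obtain ⟨v, hv_ne, hv⟩ := exists_ne_zero_forall_isNondegenerateOn hS
  obtain ⟨z, hzv⟩ := Projective.exists_dual_ne_zero K hv_ne
  obtain ⟨x, hx⟩ := hF.exists_row_eq_of_isNondegenerateOn (hv z hzv)
  let G : S →ᵃ[K] V := F - (LinearMap.applyₗ x).toAffineMap.comp S.subtype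
  have hG_apply (s : S) : G s = F s - (s : U →ₗ[K] V) x := rfl
  have hG : IsRangeCompatible (S := (S : Set (U →ₗ[K] V))) G := fun s =>
    Submodule.sub_mem _ (hF s) (LinearMap.mem_range_self _ x)
  have hzG (s : S) : z (G s) = 0 := by rw [hG_apply, map_sub, hx, sub_self]
  exact ⟨x, fun s => sub_eq_zero.1 (hG.eq_zero_of_row_eq_zero hS hv hzv hzG ha₀ ha₁ s)⟩

end RangeCompatibleAffine

section Optimality

variable {K U V : Type*} [Field K] [AddCommGroup U] [Module K U] [AddCommGroup V] [Module K V]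

/-- The affine space of all operators taking the value `w` at `u`, on which the bound on the
codimension is seen to be sharp. -/
def evalFiber (K : Type*) {U V : Type*} [Field K] [AddCommGroup U] [Module K U] [AddCommGroup V]
    [Module K V] (u : U) (w : V) : AffineSubspace K (U →ₗ[K] V) :=
  (AffineSubspace.mk' w ⊥).comap (LinearMap.applyₗ u).toAffineMap

theorem mem_evalFiber {u : U} {w : V} {s : U →ₗ[K] V} : s ∈ evalFiber K u w ↔ s u = w := by
  simp [evalFiber, AffineSubspace.mem_mk', sub_eq_zero]

theorem exists_linearMap_apply_eq {u : U} (hu : u ≠ 0) (w : V) : ∃ s : U →ₗ[K] V, s u = w := by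
  obtain ⟨f, hf⟩ := Projective.exists_dual_eq_one K hu
  exact ⟨f.smulRight w, by simp [hf]⟩

theorem nonempty_evalFiber {u : U} (hu : u ≠ 0) (w : V) : Nonempty (evalFiber K u w) :=
  (exists_linearMap_apply_eq hu w).elim fun s hs => ⟨s, mem_evalFiber.2 hs⟩

theorem affineCodim_evalFiber {u : U} (hu : u ≠ 0) (w : V) :
    affineCodim (evalFiber K u w) = finrank K V := by
  obtain ⟨s₀, hs₀⟩ := nonempty_evalFiber (K := K) hu w
  have hdir : (evalFiber K u w).direction =
      LinearMap.ker (LinearMap.applyₗ u : (U →ₗ[K] V) →ₗ[K] V) := by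
    ext d
    rw [← AffineSubspace.vadd_mem_iff_mem_direction d hs₀, mem_evalFiber, LinearMap.mem_ker]
    simp [mem_evalFiber.1 hs₀]
  have hsurj : Function.Surjective (LinearMap.applyₗ u : (U →ₗ[K] V) →ₗ[K] V) :=
    exists_linearMap_apply_eq hu
  rw [affineCodim, hdir]
  exact (LinearMap.quotKerEquivOfSurjective _ hsurj).finrank_eq

theorem eq_of_forall_evalFiber_eq {u : U} {w : V} [Nonempty (evalFiber K u w)]
    {L M : (U →ₗ[K] V) →ₗ[K] V} (hLM : ∀ s ∈ evalFiber K u w, L s = M s) {t : U →ₗ[K] V}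
    (ht : t u = 0) : L t = M t := by
  obtain ⟨s₀, hs₀⟩ := ‹Nonempty (evalFiber K u w)›
  have hadd : t + s₀ ∈ evalFiber K u w := by
    rw [mem_evalFiber, LinearMap.add_apply, ht, zero_add, mem_evalFiber.1 hs₀]
  simpa [hLM s₀ hs₀] using hLM _ hadd

/-- The map is `F s = φ (s u') • w` with `u'` not proportional to `u`: its values are multiples of
`w = s u`, whence range-compatibility. -/
theorem exists_isRangeCompatible_not_isLocalMap_evalFiber {u : U} (hu : u ≠ 0)
    (hU : 1 < finrank K U) {w : V} (hw : w ≠ 0) (hV : 1 < finrank K V)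
    [Nonempty (evalFiber K u w)] :
    ∃ F : evalFiber K u w →ᵃ[K] V,
      IsRangeCompatible (S := (evalFiber K u w : Set (U →ₗ[K] V))) F ∧
      ¬IsLocalMap (S := (evalFiber K u w : Set (U →ₗ[K] V))) F := by
  obtain ⟨u', huu'⟩ := exists_linearIndependent_pair_of_one_lt_finrank hU hu
  obtain ⟨w', hww'⟩ := exists_linearIndependent_pair_of_one_lt_finrank hV hw
  have hu' : u' ∉ Submodule.span K {u} := fun hmem => by
    obtain ⟨c, hc⟩ := Submodule.mem_span_singleton.1 hmem
    exact (LinearIndependent.pair_iff' hu).1 huu' c hc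
  obtain ⟨f, hfu', hf⟩ := Submodule.exists_le_ker_of_notMem hu'
  have hfu : f u = 0 := hf (Submodule.mem_span_singleton_self u)
  obtain ⟨φ, hφ⟩ := Projective.exists_dual_eq_one K hw
  let L : (U →ₗ[K] V) →ₗ[K] V := LinearMap.toSpanSingleton K V w ∘ₗ matrixCoeff φ u'
  refine ⟨L.toAffineMap.comp (evalFiber K u w).subtype, fun s => ⟨φ (s.1 u') • u, ?_⟩, ?_⟩
  · rw [map_smul, mem_evalFiber.1 s.2]
    rfl
  · rintro ⟨x, hx⟩
    have hLx (y : V) : φ (f u' • y) • w = f x • y :=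
      eq_of_forall_evalFiber_eq (L := L) (M := LinearMap.applyₗ x) (t := f.smulRight y)
        (fun s hs => hx ⟨s, hs⟩) (by simp [hfu])
    have hfx : f x = 0 := by
      have hsum : φ (f u' • w') • w + -f x • w' = 0 := by rw [hLx w', neg_smul, add_neg_cancel]
      exact neg_eq_zero.1 (LinearIndependent.pair_iff.1 hww' _ _ hsum).2
    have hfu'_smul : f u' • w = 0 := by simpa [hφ, hfx] using hLx w
    exact hfu' ((smul_eq_zero.1 hfu'_smul).resolve_right hw)

end Optimality

theorem mainTheorem2
    {K U V : Type*} [Field K] (hK : 2 < ENat.card K)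
    [AddCommGroup U] [Module K U] [FiniteDimensional K U]
    [AddCommGroup V] [Module K V] [FiniteDimensional K V] :
    (∀ (S : AffineSubspace K (U →ₗ[K] V)) [Nonempty S],
      (affineCodim S : ℤ) ≤ (Module.finrank K V : ℤ) - 1 →
        ∀ F : S →ᵃ[K] V,
          IsRangeCompatible (S := (S : Set (U →ₗ[K] V))) F →
            IsLocalMap (S := (S : Set (U →ₗ[K] V))) F) ∧
    (2 ≤ Module.finrank K U → 2 ≤ Module.finrank K V →
      ∃ (S : AffineSubspace K (U →ₗ[K] V)) (_ : Nonempty S),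
        affineCodim S = Module.finrank K V ∧
        ∃ F : S →ᵃ[K] V,
          IsRangeCompatible (S := (S : Set (U →ₗ[K] V))) F ∧
          ¬ IsLocalMap (S := (S : Set (U →ₗ[K] V))) F) := by
  refine ⟨fun S _ hS F hF => hF.isLocalMap_of_affineCodim_lt_finrank hK (by lia),
    fun hU hV => ?_⟩
  have := nontrivial_of_finrank_pos (pos_of_gt hU)
  have := nontrivial_of_finrank_pos (pos_of_gt hV)
  obtain ⟨u, hu⟩ := exists_ne (0 : U)
  obtain ⟨w, hw⟩ := exists_ne (0 : V)
  have hne := nonempty_evalFiber (K := K) hu w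
  exact ⟨evalFiber K u w, hne, affineCodim_evalFiber hu w,
    exists_isRangeCompatible_not_isLocalMap_evalFiber hu hU hw hV⟩
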